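/- Let $m\ge 1$ and $k\ge 2$ be integers and let $\rho_1,\dots,\rho_{k-1}\in\mathbb R$ satisfy $1-\rho_j^2\in(0,1)$. Let $(X_{i1},\dots,X_{ik})$, $1\le i\le m$, be independent, identically distributed random vectors with $$(X_{i1},\dots,X_{ik})\overset{d}{=}(\xi,\ \rho_1\xi+W_1,\ \dots,\ \rho_{k-1}\xi+W_{k-1}),$$ where $\xi$ is standard normal and independent of a centered, jointly Gaussian vector $(W_1,\dots,W_{k-1})$ (with arbitrary correlations) such that $\operatorname{Var}(W_j)=1-\rho_j^2$. The vector $(\zeta_1,\dots,\zeta_k)$ with $\zeta_j=\sum_{i=1}^m X_{ij}^2$ is called a chi-square risk with $m$ degrees of freedom. Let $I_1,\dots,I_k$ be i.i.d. random signs, independent of $(\zeta_1,\dots,\zeta_k)$, with $P(I_j=1)=p=1-P(I_j=-1)$ for some $p\in(0,1]$. Let $\tilde\sigma:=\sigma_1\ge\sigma_2\ge\dots\ge\sigma_k>0$ and $\mu_1,\dots,\mu_k\in\mathbb R$, and define the log-chi risks $$Z_j=\exp\bigl(\sigma_j I_j\sqrt{\zeta_j}+\mu_j\bigr),\qquad 1\le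 j\le k.$$ Put $\tilde\mu=\max\{\mu_j:\ 1\le j\le k,\ \sigma_j=\tilde\sigma\}$ and $J_k=\#\{1\le j\le k:\ \sigma_j=\tilde\sigma,\ \mu_j=\tilde\mu\}$. Assume that for any two distinct indices $a,b$ with $\sigma_a=\sigma_b=\tilde\sigma$ the correlation coefficient of $X_{1a}$ and $X_{1b}$ lies in $(-1,1)$. Then, as $u\to\infty$, $$P\Bigl(\sum_{j=1}^k Z_j>u\Bigr)=\frac{p\,J_k}{2^{m/2-1}\,\Gamma(m/2)\,\tilde\sigma^{\,m-2}}\,(\ln u-\tilde\mu)^{m-2}\exp\Bigl(-\frac{(\ln u-\tilde\mu)^2}{2\tilde\sigma^2}\Bigr)(1+o(1)).$$ -/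

import Mathlib

open MeasureTheory ProbabilityTheory Filter Asymptotics

/-- The law of `(X₁, ρ₁ X₁ + W₁, …, ρₙ X₁ + Wₙ)`, where `X₁` is standard normal and independent of
the random vector `W = (W₁, …, Wₙ)`, which has law `ν`. -/
noncomputable def chiRowLaw {n : ℕ} (ρ : Fin n → ℝ) (ν : Measure (Fin n → ℝ)) :
    Measure (Fin (n + 1) → ℝ) :=
  ((gaussianReal 0 1).prod ν).map
    (fun x => (Fin.cons x.1 (fun j => ρ j * x.1 + x.2 j) : Fin (n + 1) → ℝ))

/-- `X` is the `m × (n + 1)` random array underlying the (classical) `(n + 1)`-dimensional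
chi-square risk with `m` degrees of freedom and parameters `ρ₁, …, ρₙ`: its rows are independent,
and each row is distributed as `(X₁, ρ₁ X₁ + W₁, …, ρₙ X₁ + Wₙ)`, with `X₁` standard normal and
independent of a centered Gaussian vector `W` (with the same law for all rows), arbitrarily
correlated, such that `Wⱼ` has variance `1 - ρⱼ² ∈ (0, 1)`. -/
structure IsChiSquareArray {Ω : Type*} [MeasurableSpace Ω] (P : Measure Ω) {m n : ℕ}
    (ρ : Fin n → ℝ) (X : Fin m → Fin (n + 1) → Ω → ℝ) : Prop where
  measurable : ∀ i j, Measurable (X i j)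
  rho_mem : ∀ j, 1 - ρ j ^ 2 ∈ Set.Ioo (0 : ℝ) 1
  indep_rows : iIndepFun (fun i ω j => X i j ω) P
  law_rows : ∃ ν : Measure (Fin n → ℝ), IsGaussian ν ∧
    (∀ j, ∫ w, w j ∂ν = 0) ∧
    (∀ j, variance (fun w : Fin n → ℝ => w j) ν = 1 - ρ j ^ 2) ∧
    ∀ i, HasLaw (fun ω j => X i j ω) (chiRowLaw ρ ν) P

/-- The chi-square risk `ζⱼ = ∑ᵢ Xᵢⱼ²` of an array `X`. -/
def chiSquareRisk {Ω : Type*} {m k : ℕ} (X : Fin m → Fin k → Ω → ℝ) (j : Fin k) (ω : Ω) : ℝ :=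
  ∑ i, X i j ω ^ 2

/-- The log-chi risk `Zⱼ = exp (σⱼ Iⱼ √ζⱼ + μⱼ)`. -/
noncomputable def logChiRisk {Ω : Type*} {k : ℕ} (σ μ : Fin k → ℝ) (I ζ : Fin k → Ω → ℝ)
    (j : Fin k) (ω : Ω) : ℝ :=
  Real.exp (σ j * I j ω * Real.sqrt (ζ j ω) + μ j)

/-- `I₁, …, I_k` are independent and identically distributed random signs with
`P (Iⱼ = 1) = p = 1 - P (Iⱼ = -1)`. -/
structure IsRandomSigns {Ω : Type*} [MeasurableSpace Ω] (P : Measure Ω) {k : ℕ} (p : ℝ)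
    (I : Fin k → Ω → ℝ) : Prop where
  measurable : ∀ j, Measurable (I j)
  indep : iIndepFun I P
  prob_one : ∀ j, P.real {ω | I j ω = 1} = p
  prob_neg_one : ∀ j, P.real {ω | I j ω = -1} = 1 - p

/-- The largest `μⱼ` among the indices with `σⱼ = σ₁` (`σ₁` is `σ 0` here). -/
noncomputable def muTilde {n : ℕ} (σ μ : Fin (n + 1) → ℝ) : ℝ :=
  (Finset.univ.filter (fun j => σ j = σ 0)).sup' ⟨0, by simp⟩ μ

/-- The number of indices `j` with `σⱼ = σ₁` and `μⱼ = muTilde σ μ`. -/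
noncomputable def maxCount {n : ℕ} (σ μ : Fin (n + 1) → ℝ) : ℕ :=
  (Finset.univ.filter (fun j => σ j = σ 0 ∧ μ j = muTilde σ μ)).card

/-!
The tail of the sum is that of its largest term, and the largest terms are the `maxCount σ μ` risks
that maximize first `σⱼ` and then `μⱼ`.

*One risk.* A log-risk `σⱼ Iⱼ √ζⱼ + μⱼ` exceeds a level above `μⱼ` only if `Iⱼ = 1`, and `√ζⱼ` is
the norm of a standard Gaussian vector in dimension `m`. Polar coordinates
(`pi_gaussianReal_norm_tail`) and an integration by parts
(`integral_Ioi_isEquivalent_chiTailShape`) give its tail, a constant times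
`y ^ (m - 2) * exp (-y² / 2)`, so that with `t = log u` and `y = (t - μ̃) / σ̃` the risks with the
maximal parameters have tails of that order while the other ones are negligible. This persists for a
threshold `t - t⁻²` in place of `t` (`tendsto_marginal_div`), because `y²` changes by `O(t⁻¹)` only.

*Two risks.* If both scales are maximal, the two columns of the array are correlated with a
coefficient in `(-1, 1)`, so that rotating by 45 degrees shows that `exp (s (ζₐ + ζ_b))` is
integrable for some `s > 1 / 4` (`exists_integrable_exp_mul_sq_add_sq`). By Chernoff's bound two
log-risks exceed a level of order `t` simultaneously with a probability
`O(exp (-2 s y² (1 + o(1))))`, which is negligible as `2 s > 1 / 2`; if one of the scales is smaller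
than `σ̃`, the tail of that single risk is already negligible (`tendsto_pair_div`).

*The sum.* If the sum exceeds `exp t`, then one risk exceeds `exp (t - t⁻²)`, or two risks exceed
`exp t / (2 (n + 1) t²)` (`setOf_lt_sum_logChiRisk_subset`), whose logarithm is still of order `t`.
Conversely the sum exceeds every single risk, and Bonferroni's inequality
(`sum_measureReal_sub_le`) bounds the probability of the union from below. Both bounds have the same
leading term.
-/

open Set Topology

/-! ### The tail of the chi distribution -/

/-- The standard Gaussian measure on `ι → ℝ` has the density `(2π)^(-|ι|/2) exp (-|x|²/2)`. -/
theorem pi_gaussianReal_eq_withDensity (ι : Type*) [Fintype ι] :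
    Measure.pi (fun _ : ι => gaussianReal 0 1) =
      (volume : Measure (ι → ℝ)).withDensity (fun x => ENNReal.ofReal
        ((√(2 * Real.pi))⁻¹ ^ Fintype.card ι * Real.exp (-(∑ i, x i ^ 2) / 2))) := by
  have hden : (fun x : ι → ℝ => (√(2 * Real.pi))⁻¹ ^ Fintype.card ι *
      Real.exp (-(∑ i, x i ^ 2) / 2)) = fun x => ∏ i, gaussianPDFReal 0 1 (x i) := by
    funext x
    simp only [gaussianPDFReal, Finset.prod_mul_distrib, Finset.prod_const, Finset.card_univ,
      ← Real.exp_sum, ← Finset.sum_div, Finset.sum_neg_distrib]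
    simp
  have hint : Integrable (fun x : ι → ℝ => ∏ i, gaussianPDFReal 0 1 (x i)) :=
    Integrable.fintype_prod (fun i => integrable_gaussianPDFReal 0 1)
  symm
  refine (Measure.pi_eq fun s hs => ?_).symm
  simp_rw [congrFun hden]
  rw [withDensity_apply _ (MeasurableSet.univ_pi hs), ← ofReal_integral_eq_lintegral_ofReal
    hint.integrableOn (ae_of_all _ fun x => Finset.prod_nonneg fun i _ =>
      gaussianPDFReal_nonneg 0 1 (x i)), volume_pi, Measure.restrict_pi_pi,
    integral_fintype_prod_eq_prod (fun _ => gaussianPDFReal 0 1), ENNReal.ofReal_prod_of_nonneg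
    (fun i _ => integral_nonneg fun x => gaussianPDFReal_nonneg 0 1 x)]
  refine Finset.prod_congr rfl fun i _ => ?_
  rw [gaussianReal_apply_eq_integral 0 one_ne_zero]

/-- Tail of the chi distribution: integrating the Gaussian density in polar coordinates. -/
theorem pi_gaussianReal_norm_tail (m : ℕ) (hm : 1 ≤ m) {r : ℝ} (hr : 0 ≤ r) :
    (Measure.pi (fun _ : Fin m => gaussianReal 0 1)).real {x | r < √(∑ i, x i ^ 2)} =
      ((2 : ℝ) ^ ((m : ℝ) / 2 - 1) * Real.Gamma ((m : ℝ) / 2))⁻¹ *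
        ∫ y in Ioi r, y ^ (m - 1) * Real.exp (-y ^ 2 / 2) := by
  have : Nonempty (Fin m) := ⟨⟨0, hm⟩⟩
  set c : ℝ := (√(2 * Real.pi))⁻¹ ^ m with hc
  have hc0 : 0 < c := by positivity
  have hS : MeasurableSet {x : Fin m → ℝ | r < √(∑ i, x i ^ 2)} :=
    measurableSet_lt measurable_const (by fun_prop)
  have hmeas : AEStronglyMeasurable (fun x : Fin m → ℝ => c * Real.exp (-(∑ i, x i ^ 2) / 2))
      (volume.restrict {x : Fin m → ℝ | r < √(∑ i, x i ^ 2)}) :=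
    (by fun_prop : Continuous _).aestronglyMeasurable
  have h1 : (Measure.pi (fun _ : Fin m => gaussianReal 0 1)).real {x | r < √(∑ i, x i ^ 2)} =
      ∫ x : Fin m → ℝ in {x | r < √(∑ i, x i ^ 2)}, c * Real.exp (-(∑ i, x i ^ 2) / 2) := by
    rw [integral_eq_lintegral_of_nonneg_ae (ae_of_all _ fun x => by positivity) hmeas,
      Measure.real, pi_gaussianReal_eq_withDensity, withDensity_apply _ hS, Fintype.card_fin]
  rw [h1, ← integral_indicator hS]
  have h2 : ({x : Fin m → ℝ | r < √(∑ i, x i ^ 2)}.indicator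
      fun x => c * Real.exp (-(∑ i, x i ^ 2) / 2)) =
      fun x => (fun z : EuclideanSpace ℝ (Fin m) =>
        (Ioi r).indicator (fun y => c * Real.exp (-y ^ 2 / 2)) ‖z‖) (WithLp.toLp 2 x) := by
    funext x
    have hsum : 0 ≤ ∑ i, x i ^ 2 := Finset.sum_nonneg fun i _ => sq_nonneg _
    simp only [indicator, mem_ofPred_eq, mem_Ioi, EuclideanSpace.norm_eq, Real.norm_eq_abs, sq_abs,
      Real.sq_sqrt hsum]
  rw [h2, (PiLp.volume_preserving_toLp (Fin m)).integral_comp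
    (MeasurableEquiv.toLp 2 (Fin m → ℝ)).measurableEmbedding, integral_fun_norm_addHaar,
    finrank_euclideanSpace, Fintype.card_fin, Measure.real, EuclideanSpace.volume_ball]
  have h3 : ∫ y in Ioi (0 : ℝ), y ^ (m - 1) • (Ioi r).indicator
      (fun y => c * Real.exp (-y ^ 2 / 2)) y =
      c * ∫ y in Ioi r, y ^ (m - 1) * Real.exp (-y ^ 2 / 2) := by
    have : (fun y : ℝ => y ^ (m - 1) • (Ioi r).indicator (fun y => c * Real.exp (-y ^ 2 / 2)) y) =
        (Ioi r).indicator (fun y => c * (y ^ (m - 1) * Real.exp (-y ^ 2 / 2))) := by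
      funext y
      by_cases hy : y ∈ Ioi r
      · simp only [indicator_of_mem hy, smul_eq_mul]; ring
      · simp only [indicator_of_notMem hy, smul_zero]
    rw [this, setIntegral_indicator measurableSet_Ioi,
      inter_eq_right.2 (Ioi_subset_Ioi hr), integral_const_mul]
  rw [h3, nsmul_eq_mul, smul_eq_mul, ← mul_assoc, ← mul_assoc]
  congr 1
  have hm0 : (0 : ℝ) < m := by exact_mod_cast hm
  have hG : 0 < Real.Gamma ((m : ℝ) / 2) := Real.Gamma_pos_of_pos (by positivity)
  rw [Fintype.card_fin, ENNReal.ofReal_one, one_pow, one_mul,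
    ENNReal.toReal_ofReal (div_nonneg (by positivity)
      (Real.Gamma_pos_of_pos (by positivity)).le),
    Real.Gamma_add_one (by positivity), hc, inv_pow, Real.sqrt_mul (by norm_num), mul_pow]
  have h2m : (2 : ℝ) ^ ((m : ℝ) / 2 - 1) = √2 ^ m / 2 := by
    rw [Real.rpow_sub_one (by norm_num), Real.sqrt_eq_rpow, ← Real.rpow_natCast,
      ← Real.rpow_mul (by norm_num)]
    ring_nf
  rw [h2m]
  have hpi : (√Real.pi) ≠ 0 := (Real.sqrt_pos.2 Real.pi_pos).ne'
  field_simp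

/-- The function `y ↦ y ^ (m - 2) * exp (-y² / 2)`, to which the tail of the chi distribution with
`m` degrees of freedom is proportional at infinity. The exponent is an integer, as `m = 1` is
allowed. -/
noncomputable def chiTailShape (m : ℕ) (y : ℝ) : ℝ :=
  y ^ ((m : ℤ) - 2) * Real.exp (-y ^ 2 / 2)

theorem chiTailShape_pos (m : ℕ) {y : ℝ} (hy : 0 < y) : 0 < chiTailShape m y :=
  mul_pos (zpow_pos hy _) (Real.exp_pos _)

theorem tendsto_zpow_mul_exp_neg_mul_sq (k : ℤ) {b : ℝ} (hb : 0 < b) :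
    Tendsto (fun y : ℝ => y ^ k * Real.exp (-b * y ^ 2)) atTop (𝓝 0) := by
  have h := (rpow_mul_exp_neg_mul_sq_isLittleO_exp_neg hb (k : ℝ)).trans_tendsto
    (Real.tendsto_exp_atBot.comp
      (tendsto_id.const_mul_atTop_of_neg (by norm_num : -(1 / 2 : ℝ) < 0)))
  simpa only [Real.rpow_intCast] using h

/-- The derivative of `-y ^ (m - 2) * exp (-y² / 2)` is `y ^ (m - 1) * exp (-y² / 2)` up to a
relative error `(m - 2) / y²`. -/
theorem hasDerivAt_neg_chiTailShape (m : ℕ) (hm : 1 ≤ m) {y : ℝ} (hy : 0 < y) :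
    HasDerivAt (fun y => -chiTailShape m y)
      (y ^ (m - 1) * Real.exp (-y ^ 2 / 2) * (1 - ((m : ℝ) - 2) / y ^ 2)) y := by
  have h1 := hasDerivAt_zpow ((m : ℤ) - 2) y (Or.inl hy.ne')
  have h2 : HasDerivAt (fun y : ℝ => Real.exp (-y ^ 2 / 2)) (Real.exp (-y ^ 2 / 2) * (-y)) y := by
    refine HasDerivAt.exp ?_
    exact ((hasDerivAt_pow 2 y).fun_neg.div_const 2).congr_deriv (by simp; ring)
  refine (h1.fun_mul h2).fun_neg.congr_deriv ?_
  have e1 : y ^ ((m : ℤ) - 2 - 1) = y ^ (m - 1) / y ^ 2 := by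
    rw [← zpow_natCast, ← zpow_natCast, ← zpow_sub₀ hy.ne']
    congr 1; omega
  have e2 : y ^ ((m : ℤ) - 2) = y ^ (m - 1) / y := by
    rw [← zpow_natCast, div_eq_mul_inv, ← zpow_sub_one₀ hy.ne']
    congr 1; omega
  rw [e1, e2]
  push_cast
  field_simp
  ring

theorem integral_Ioi_isEquivalent_chiTailShape (m : ℕ) (hm : 1 ≤ m) :
    (fun r : ℝ => ∫ y in Ioi r, y ^ (m - 1) * Real.exp (-y ^ 2 / 2)) ~[atTop] chiTailShape m := by
  have hlim : Tendsto (chiTailShape m) atTop (𝓝 0) := by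
    have := tendsto_zpow_mul_exp_neg_mul_sq ((m : ℤ) - 2) (b := 1 / 2) (by norm_num)
    refine this.congr fun y => ?_
    unfold chiTailShape; congr 2; ring
  have hgi : Integrable (fun y : ℝ => y ^ (m - 1) * Real.exp (-y ^ 2 / 2)) := by
    have := integrable_rpow_mul_exp_neg_mul_sq (b := 1 / 2) (by norm_num) (s := (m - 1 : ℕ))
      (by have : (0 : ℝ) ≤ (m - 1 : ℕ) := by positivity
          linarith)
    refine this.congr (ae_of_all _ fun y => ?_)
    simp only [Real.rpow_natCast]; congr 2; ring
  have key : ∀ r : ℝ, (m : ℝ) + 1 ≤ r →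
      |(∫ y in Ioi r, y ^ (m - 1) * Real.exp (-y ^ 2 / 2)) - chiTailShape m r| ≤
        (m + 1) / r ^ 2 * ∫ y in Ioi r, y ^ (m - 1) * Real.exp (-y ^ 2 / 2) := by
    intro r hr
    have hm0 : (1 : ℝ) ≤ m := by exact_mod_cast hm
    have hr0 : 0 < r := by linarith
    have hsmall : ∀ y ∈ Ioi r, |((m : ℝ) - 2) / y ^ 2| ≤ (m + 1) / r ^ 2 := by
      intro y hy
      have hy : r < y := hy
      have hy0 : 0 < y := hr0.trans hy
      rw [abs_div, abs_of_pos (by positivity : 0 < y ^ 2)]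
      refine div_le_div₀ (by positivity) ?_ (by positivity) (by gcongr)
      rw [abs_le]; constructor <;> linarith
    have hone : ((m : ℝ) + 1) / r ^ 2 ≤ 1 := by
      rw [div_le_one (by positivity)]; nlinarith
    have hd : ∀ y ∈ Ici r, HasDerivAt (fun y => -chiTailShape m y)
        (y ^ (m - 1) * Real.exp (-y ^ 2 / 2) * (1 - ((m : ℝ) - 2) / y ^ 2)) y :=
      fun y hy => hasDerivAt_neg_chiTailShape m hm (hr0.trans_le hy)
    have hnn : ∀ y ∈ Ioi r, 0 ≤
        y ^ (m - 1) * Real.exp (-y ^ 2 / 2) * (1 - ((m : ℝ) - 2) / y ^ 2) := by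
      intro y hy
      have hy0 : 0 < y := hr0.trans hy
      have := (abs_le.1 ((hsmall y hy).trans hone)).2
      exact mul_nonneg (by positivity) (by linarith)
    have hlim' : Tendsto (fun y => -chiTailShape m y) atTop (𝓝 0) := by simpa using hlim.neg
    have hI := integral_Ioi_of_hasDerivAt_of_nonneg' hd hnn hlim'
    have hIi := integrableOn_Ioi_deriv_of_nonneg' hd hnn hlim'
    rw [zero_sub, neg_neg] at hI
    rw [← hI, ← integral_sub hgi.integrableOn hIi, ← integral_const_mul, ← Real.norm_eq_abs]
    refine norm_integral_le_of_norm_le (hgi.integrableOn.const_mul _) ?_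
    filter_upwards [self_mem_ae_restrict measurableSet_Ioi] with y hy
    have hy0 : 0 < y := hr0.trans hy
    rw [Real.norm_eq_abs, show y ^ (m - 1) * Real.exp (-y ^ 2 / 2) -
      y ^ (m - 1) * Real.exp (-y ^ 2 / 2) * (1 - ((m : ℝ) - 2) / y ^ 2) =
      ((m : ℝ) - 2) / y ^ 2 * (y ^ (m - 1) * Real.exp (-y ^ 2 / 2)) by ring, abs_mul,
      abs_of_pos (by positivity : 0 < y ^ (m - 1) * Real.exp (-y ^ 2 / 2))]
    gcongr
    exact hsmall y hy
  symm
  refine IsLittleO.of_bound fun ε hε => ?_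
  have ht : Tendsto (fun r : ℝ => ((m : ℝ) + 1) / r ^ 2) atTop (𝓝 0) :=
    tendsto_const_nhds.div_atTop (tendsto_pow_atTop two_ne_zero)
  filter_upwards [eventually_ge_atTop ((m : ℝ) + 1), ht.eventually_lt_const hε] with r hr hε'
  have hnn : 0 ≤ ∫ y in Ioi r, y ^ (m - 1) * Real.exp (-y ^ 2 / 2) := by
    refine setIntegral_nonneg measurableSet_Ioi fun y hy => ?_
    have : 0 < y := lt_trans (by positivity) (hr.trans_lt hy)
    positivity
  simp only [Pi.sub_apply, Real.norm_eq_abs]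
  rw [abs_sub_comm, abs_of_nonneg hnn]
  exact (key r hr).trans (by gcongr)

/-! ### The rows of the array and exponential moments of chi-square risks -/

theorem isGaussian_chiRowLaw {n : ℕ} (ρ : Fin n → ℝ) (ν : Measure (Fin n → ℝ)) [IsGaussian ν] :
    IsGaussian (chiRowLaw ρ ν) := by
  let L : ℝ × (Fin n → ℝ) →L[ℝ] (Fin (n + 1) → ℝ) := ContinuousLinearMap.pi
    (Fin.cons (ContinuousLinearMap.fst ℝ ℝ (Fin n → ℝ)) fun j =>
      ρ j • ContinuousLinearMap.fst ℝ ℝ (Fin n → ℝ) +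
        (ContinuousLinearMap.proj j).comp (ContinuousLinearMap.snd ℝ ℝ (Fin n → ℝ)))
  have hL : (fun x : ℝ × (Fin n → ℝ) =>
      (Fin.cons x.1 (fun j => ρ j * x.1 + x.2 j) : Fin (n + 1) → ℝ)) = L := by
    funext x j
    refine Fin.cases ?_ (fun j => ?_) j <;> simp [L]
  rw [chiRowLaw, hL]
  infer_instance

/-- Every entry of the array is standard normal. -/
theorem chiRowLaw_map_eval {n : ℕ} (ρ : Fin n → ℝ) (ν : Measure (Fin n → ℝ)) [IsGaussian ν]
    (hρ : ∀ j, 0 < 1 - ρ j ^ 2) (hmean : ∀ j, ∫ w, w j ∂ν = 0)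
    (hvar : ∀ j, variance (fun w : Fin n → ℝ => w j) ν = 1 - ρ j ^ 2) (j : Fin (n + 1)) :
    (chiRowLaw ρ ν).map (fun x => x j) = gaussianReal 0 1 := by
  have hmeas : Measurable (fun x : ℝ × (Fin n → ℝ) =>
      (Fin.cons x.1 (fun j => ρ j * x.1 + x.2 j) : Fin (n + 1) → ℝ)) := by
    refine measurable_pi_lambda _ fun j => ?_
    refine Fin.cases ?_ (fun j => ?_) j
    · simpa using measurable_fst
    · simp only [Fin.cons_succ]; fun_prop
  rw [chiRowLaw, Measure.map_map (by fun_prop) hmeas]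
  refine Fin.cases ?_ (fun j => ?_) j
  · exact measurePreserving_fst.map_eq
  · have hW : HasLaw (fun x : ℝ × (Fin n → ℝ) => x.2 j) (gaussianReal 0 (1 - ρ j ^ 2).toNNReal)
        ((gaussianReal 0 1).prod ν) := by
      refine ⟨by fun_prop, ?_⟩
      have h1 : ((gaussianReal 0 1).prod ν).map (fun x => x.2 j) = ν.map (fun w => w j) := by
        conv_rhs => rw [← (measurePreserving_snd (μ := gaussianReal 0 1) (ν := ν)).map_eq]
        rw [Measure.map_map (by fun_prop) measurable_snd]
        rfl
      have h2 : HasGaussianLaw (fun w : Fin n → ℝ => w j) ν :=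
        (IsGaussian.hasGaussianLaw_id (μ := ν)).eval j
      rw [h1, h2.map_eq_gaussianReal, hmean j, hvar j]
    have hξ : HasLaw (fun x : ℝ × (Fin n → ℝ) => ρ j * x.1)
        (gaussianReal (ρ j * 0) (.mk (ρ j ^ 2) (sq_nonneg _) * 1)) ((gaussianReal 0 1).prod ν) :=
      gaussianReal_const_mul ⟨by fun_prop, measurePreserving_fst.map_eq⟩ (ρ j)
    have hind : IndepFun (fun x : ℝ × (Fin n → ℝ) => ρ j * x.1) (fun x => x.2 j)
        ((gaussianReal 0 1).prod ν) :=
      indepFun_prod (X := fun t : ℝ => ρ j * t) (Y := fun w : Fin n → ℝ => w j)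
        (by fun_prop) (by fun_prop)
    have := gaussianReal_add_gaussianReal_of_indepFun hind hξ.map_eq hW.map_eq
    have hfun : ((fun x : Fin (n + 1) → ℝ => x j.succ) ∘ fun x : ℝ × (Fin n → ℝ) =>
        (Fin.cons x.1 (fun j => ρ j * x.1 + x.2 j) : Fin (n + 1) → ℝ)) =
        (fun x => ρ j * x.1) + fun x => x.2 j := by
      funext x; simp
    rw [hfun, this]
    congr 1
    · simp
    · refine NNReal.eq ?_
      rw [NNReal.coe_add, NNReal.coe_mul, NNReal.coe_mk, Real.coe_toNNReal _ (hρ j).le]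
      simp

theorem integrable_exp_mul_sq_gaussianReal {v : NNReal} {t : ℝ} (h : t * v < 1 / 2) :
    Integrable (fun x => Real.exp (t * x ^ 2)) (gaussianReal 0 v) := by
  rcases eq_or_ne v 0 with rfl | hv
  · rw [gaussianReal_zero_var]
    exact integrable_dirac (by simp)
  · have hv0 : (0 : ℝ) < v := by positivity
    rw [gaussianReal_of_var_ne_zero 0 hv, integrable_withDensity_iff_integrable_smul'
      (measurable_gaussianPDF 0 v) (ae_of_all _ fun x => gaussianPDF_lt_top)]
    have hb : 0 < 1 / (2 * (v : ℝ)) - t := by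
      rw [sub_pos, lt_div_iff₀ (by positivity)]; linarith
    refine ((integrable_exp_neg_mul_sq hb).const_mul (√(2 * Real.pi * v))⁻¹).congr
      (ae_of_all _ fun x => ?_)
    simp only [toReal_gaussianPDF, gaussianPDFReal, smul_eq_mul]
    rw [mul_assoc (√(2 * Real.pi * v))⁻¹, ← Real.exp_add]
    congr 2
    field_simp
    ring

theorem HasGaussianLaw.integrable_exp_mul_sq {Ω : Type*} [MeasurableSpace Ω] {P : Measure Ω}
    {Y : Ω → ℝ} (hY : HasGaussianLaw Y P) (hmean : ∫ ω, Y ω ∂P = 0) {t : ℝ}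
    (ht : t * variance Y P < 1 / 2) : Integrable (fun ω => Real.exp (t * Y ω ^ 2)) P := by
  have hv : t * ((variance Y P).toNNReal : ℝ) < 1 / 2 := by
    rwa [Real.coe_toNNReal _ (variance_nonneg Y P)]
  have h := integrable_exp_mul_sq_gaussianReal hv
  rw [← hmean, ← hY.map_eq_gaussianReal] at h
  exact h.comp_aemeasurable hY.aemeasurable

/-- For two jointly Gaussian standard normal variables with `|cov (X, Y)| < 1`, the exponential
moment of `X² + Y²` is finite up to a parameter exceeding `1 / 4`: the rotated variables `X + Y` and
`X - Y` are independent, with variances `2 ± 2 cov (X, Y) < 4`. -/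
theorem exists_integrable_exp_mul_sq_add_sq {Ω : Type*} [MeasurableSpace Ω] {P : Measure Ω}
    [IsProbabilityMeasure P] {X Y : Ω → ℝ} (hXY : HasGaussianLaw (fun ω => (X ω, Y ω)) P)
    (hX : P.map X = gaussianReal 0 1) (hY : P.map Y = gaussianReal 0 1)
    (hcov : |covariance X Y P| < 1) :
    ∃ s : ℝ, 1 / 4 < s ∧ ∀ t ≤ s, Integrable (fun ω => Real.exp (t * (X ω ^ 2 + Y ω ^ 2))) P := by
  have hmX : ∫ ω, X ω ∂P = 0 := by
    have := (HasLaw.mk hXY.fst.aemeasurable hX).integral_eq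
    rw [this]; exact integral_id_gaussianReal
  have hmY : ∫ ω, Y ω ∂P = 0 := by
    have := (HasLaw.mk hXY.snd.aemeasurable hY).integral_eq
    rw [this]; exact integral_id_gaussianReal
  have hvX : variance X P = 1 := by
    have := (HasLaw.mk hXY.fst.aemeasurable hX).variance_eq
    rw [this, variance_id_gaussianReal]; rfl
  have hvY : variance Y P = 1 := by
    have := (HasLaw.mk hXY.snd.aemeasurable hY).variance_eq
    rw [this, variance_id_gaussianReal]; rfl
  have hX2 := hXY.fst.memLp_two
  have hY2 := hXY.snd.memLp_two
  have hUV : HasGaussianLaw (fun ω => ((X + Y) ω, (X - Y) ω)) P :=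
    hXY.map_fun ((ContinuousLinearMap.fst ℝ ℝ ℝ + ContinuousLinearMap.snd ℝ ℝ ℝ).prod
      (ContinuousLinearMap.fst ℝ ℝ ℝ - ContinuousLinearMap.snd ℝ ℝ ℝ))
  have hind : IndepFun (X + Y) (X - Y) P := by
    refine hUV.indepFun_of_covariance_eq_zero ?_
    rw [covariance_add_left hX2 hY2 (hX2.sub hY2), covariance_sub_right hX2 hX2 hY2,
      covariance_sub_right hY2 hX2 hY2, covariance_self hX2.aemeasurable,
      covariance_self hY2.aemeasurable, covariance_comm Y X, hvX, hvY]
    ring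
  obtain ⟨h1, h2⟩ := abs_lt.1 hcov
  set r := covariance X Y P with hr
  have hpos : 0 < 1 + |r| := by positivity
  -- `X² + Y² = (X + Y)² / 2 + (X - Y)² / 2`, and the larger of the two variances is `2 + 2 |r|`
  obtain ⟨s, hs1, hs2⟩ : ∃ s : ℝ, 1 / 4 < s ∧ s < 1 / (2 * (1 + |r|)) :=
    exists_between (by rw [div_lt_div_iff₀ (by norm_num) (by positivity)]; linarith)
  refine ⟨s, hs1, fun t ht => ?_⟩
  have hs0 : 0 < s := by linarith
  rw [lt_div_iff₀ (by positivity)] at hs2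
  have hbound : ∀ a : ℝ, 0 ≤ a → a ≤ 2 + 2 * |r| → t / 2 * a < 1 / 2 := by
    intro a ha0 ha
    have : t * a ≤ s * (2 + 2 * |r|) := by
      calc t * a ≤ s * a := by gcongr
        _ ≤ _ := by gcongr
    linarith
  have hU : Integrable (fun ω => Real.exp (t / 2 * (X + Y) ω ^ 2)) P := by
    refine HasGaussianLaw.integrable_exp_mul_sq hUV.fst ?_ (hbound _ (variance_nonneg _ _) ?_)
    · simp only [Pi.add_apply]
      rw [integral_add hXY.fst.integrable hXY.snd.integrable, hmX, hmY, add_zero]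
    · have : variance (X + Y) P = 2 + 2 * r := by rw [variance_add hX2 hY2, hvX, hvY]; ring
      linarith [le_abs_self r]
  have hV : Integrable (fun ω => Real.exp (t / 2 * (X - Y) ω ^ 2)) P := by
    refine HasGaussianLaw.integrable_exp_mul_sq hUV.snd ?_ (hbound _ (variance_nonneg _ _) ?_)
    · simp only [Pi.sub_apply]
      rw [integral_sub hXY.fst.integrable hXY.snd.integrable, hmX, hmY, sub_zero]
    · have : variance (X - Y) P = 2 - 2 * r := by rw [variance_sub hX2 hY2, hvX, hvY]; ring
      linarith [neg_abs_le r]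
  have hprod := (hind.comp (φ := fun z : ℝ => Real.exp (t / 2 * z ^ 2))
    (ψ := fun z : ℝ => Real.exp (t / 2 * z ^ 2)) (by fun_prop) (by fun_prop)).integrable_mul hU hV
  refine hprod.congr (ae_of_all _ fun ω => ?_)
  simp only [Pi.mul_apply, Function.comp_apply, Pi.add_apply, Pi.sub_apply, ← Real.exp_add]
  ring_nf

section Array

variable {Ω : Type*} [MeasurableSpace Ω] {P : Measure Ω} {m n : ℕ}
  {ρ : Fin n → ℝ} {X : Fin m → Fin (n + 1) → Ω → ℝ}

theorem IsChiSquareArray.hasGaussianLaw_row (hX : IsChiSquareArray P ρ X) (i : Fin m) :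
    HasGaussianLaw (fun ω j => X i j ω) P := by
  obtain ⟨ν, hν, -, -, hlaw⟩ := hX.law_rows
  have := isGaussian_chiRowLaw ρ ν
  exact (hlaw i).hasGaussianLaw

theorem IsChiSquareArray.map_entry (hX : IsChiSquareArray P ρ X) (i : Fin m) (j : Fin (n + 1)) :
    P.map (X i j) = gaussianReal 0 1 := by
  obtain ⟨ν, hν, hmean, hvar, hlaw⟩ := hX.law_rows
  rw [← chiRowLaw_map_eval ρ ν (fun j => (hX.rho_mem j).1) hmean hvar j, ← (hlaw i).map_eq,
    Measure.map_map (by fun_prop) (measurable_pi_lambda _ fun j => hX.measurable i j)]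
  rfl

theorem IsChiSquareArray.measurable_chiSquareRisk (hX : IsChiSquareArray P ρ X)
    (j : Fin (n + 1)) : Measurable (chiSquareRisk X j) :=
  Finset.measurable_sum _ fun i _ => (hX.measurable i j).pow_const 2

theorem chiSquareRisk_nonneg {Ω : Type*} {m k : ℕ} (X : Fin m → Fin k → Ω → ℝ) (j : Fin k)
    (ω : Ω) : 0 ≤ chiSquareRisk X j ω :=
  Finset.sum_nonneg fun _ _ => sq_nonneg _

/-- `√ζⱼ` has the chi distribution with `m` degrees of freedom. -/
theorem IsChiSquareArray.measureReal_lt_sqrt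
    (hX : IsChiSquareArray P ρ X) (hm : 1 ≤ m)
    (j : Fin (n + 1)) {r : ℝ} (hr : 0 ≤ r) :
    P.real {ω | r < √(chiSquareRisk X j ω)} =
      ((2 : ℝ) ^ ((m : ℝ) / 2 - 1) * Real.Gamma ((m : ℝ) / 2))⁻¹ *
        ∫ y in Ioi r, y ^ (m - 1) * Real.exp (-y ^ 2 / 2) := by
  have hind : iIndepFun (fun i => X i j) P :=
    hX.indep_rows.comp (fun _ x => x j) fun _ => measurable_pi_apply j
  have hlaw : HasLaw (fun ω i => X i j ω) (Measure.pi fun _ : Fin m => gaussianReal 0 1) P := by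
    refine ⟨(measurable_pi_lambda _ fun i => hX.measurable i j).aemeasurable, ?_⟩
    rw [hind.map_fun_eq_pi_map fun i => (hX.measurable i j).aemeasurable]
    congr 1; funext i; exact hX.map_entry i j
  rw [← pi_gaussianReal_norm_tail m hm hr]
  exact hlaw.measureReal_eq (p := fun x : Fin m → ℝ => r < √(∑ i, x i ^ 2))
    (measurableSet_lt measurable_const (by fun_prop))

variable [IsProbabilityMeasure P]

theorem integrable_exp_mul_sum_of_indep {Y : Fin m → Ω → ℝ} (hind : iIndepFun Y P)
    (hmeas : ∀ i, Measurable (Y i)) {s : ℝ}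
    (hint : ∀ i, Integrable (fun ω => Real.exp (s * Y i ω)) P) :
    Integrable (fun ω => Real.exp (s * ∑ i, Y i ω)) P := by
  have := hind.integrable_exp_mul_sum hmeas (s := Finset.univ) fun i _ => hint i
  simpa only [Finset.sum_apply] using this

theorem IsChiSquareArray.integrable_exp (hX : IsChiSquareArray P ρ X) (a : Fin (n + 1)) {s : ℝ}
    (hs : s < 1 / 2) : Integrable (fun ω => Real.exp (s * chiSquareRisk X a ω)) P := by
  refine integrable_exp_mul_sum_of_indep (Y := fun i ω => X i a ω ^ 2)
    (hX.indep_rows.comp (fun _ x => x a ^ 2) fun _ => (measurable_pi_apply a).pow_const 2)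
    (fun i => (hX.measurable i a).pow_const 2) fun i => ?_
  have h := integrable_exp_mul_sq_gaussianReal (v := 1) (t := s) (by simpa using hs)
  rw [← hX.map_entry i a] at h
  exact h.comp_measurable (hX.measurable i a)

theorem IsChiSquareArray.exists_integrable_exp_add (hX : IsChiSquareArray P ρ X)
    {a b : Fin (n + 1)} (hcorr : ∀ i, |covariance (X i a) (X i b) P| < 1) :
    ∃ s : ℝ, 1 / 4 < s ∧
      Integrable (fun ω => Real.exp (s * (chiSquareRisk X a ω + chiSquareRisk X b ω))) P := by
  choose s hs hint using fun i => exists_integrable_exp_mul_sq_add_sq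
    ((hX.hasGaussianLaw_row i).prodMk a b) (hX.map_entry i a) (hX.map_entry i b) (hcorr i)
  -- each row provides a parameter; a common one is below all of these and still above `1 / 4`
  obtain ⟨t, ht, hts⟩ : ∃ t : ℝ, 1 / 4 < t ∧ ∀ i, t ≤ s i := by
    have := (Filter.eventually_all.2 fun i =>
      (eventually_le_nhds (hs i)).filter_mono nhdsWithin_le_nhds).and
        (eventually_mem_nhdsWithin (a := (1 / 4 : ℝ)) (s := Ioi (1 / 4)))
    obtain ⟨t, h1, h2⟩ := this.exists
    exact ⟨t, h2, h1⟩
  refine ⟨t, ht, ?_⟩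
  have := integrable_exp_mul_sum_of_indep (P := P) (s := t)
    (Y := fun i ω => X i a ω ^ 2 + X i b ω ^ 2)
    (hX.indep_rows.comp (fun _ x => x a ^ 2 + x b ^ 2) fun _ =>
      ((measurable_pi_apply a).pow_const 2).add ((measurable_pi_apply b).pow_const 2))
    (fun i => ((hX.measurable i a).pow_const 2).add ((hX.measurable i b).pow_const 2))
    fun i => hint i t (hts i)
  simpa only [Finset.sum_add_distrib, chiSquareRisk] using this

end Array

/-! ### Comparison of tails, and bounds for sums and unions -/

theorem tendsto_chiTailShape_div {α : Type*} {l : Filter α} (m : ℕ) {x y : α → ℝ} {q c : ℝ}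
    (hq : 0 < q) (hy : Tendsto y l atTop) (hxy : Tendsto (fun t => x t / y t) l (𝓝 q))
    (hexp : Tendsto (fun t => Real.exp ((y t ^ 2 - x t ^ 2) / 2)) l (𝓝 c)) :
    Tendsto (fun t => chiTailShape m (x t) / chiTailShape m (y t)) l
      (𝓝 (q ^ ((m : ℤ) - 2) * c)) := by
  refine ((hxy.zpow₀ _ (Or.inl hq.ne')).mul hexp).congr' ?_
  filter_upwards [hy.eventually_gt_atTop 0] with t ht
  rw [chiTailShape, chiTailShape, mul_div_mul_comm, div_zpow, ← Real.exp_sub]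
  congr 2; ring

/-- Gaussian decay at a rate `c > 1 / 2` is negligible against the tail of the chi distribution,
whatever the number of degrees of freedom. -/
theorem tendsto_exp_neg_div_chiTailShape {α : Type*} {l : Filter α} (m : ℕ) {E y : α → ℝ} {c : ℝ}
    (hc : 1 / 2 < c) (hy : Tendsto y l atTop) (hE : Tendsto (fun t => E t / y t ^ 2) l (𝓝 c)) :
    Tendsto (fun t => Real.exp (-E t) / chiTailShape m (y t)) l (𝓝 0) := by
  obtain ⟨η, hη1, hη2⟩ := exists_between hc
  have hlim := (tendsto_zpow_mul_exp_neg_mul_sq (-((m : ℤ) - 2)) (sub_pos.2 hη1)).comp hy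
  refine squeeze_zero' ?_ ?_ hlim
  · filter_upwards [hy.eventually_gt_atTop 0] with t ht
    exact div_nonneg (Real.exp_pos _).le (chiTailShape_pos m ht).le
  · filter_upwards [hy.eventually_gt_atTop 0, hE.eventually_const_lt hη2] with t ht hEt
    rw [lt_div_iff₀ (by positivity)] at hEt
    rw [div_le_iff₀ (chiTailShape_pos m ht), Function.comp_apply, chiTailShape, mul_mul_mul_comm,
      ← zpow_add₀ ht.ne', ← Real.exp_add]
    rw [neg_add_cancel, zpow_zero, one_mul, Real.exp_le_exp]
    linarith

/-- If a sum of `n + 1` numbers exceeds `u` although no term exceeds `(1 - δ) u`, then two of the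
terms exceed `δ u / (n + 1)`. -/
theorem exists_ne_lt_of_lt_sum {n : ℕ} {z : Fin (n + 1) → ℝ} {u δ : ℝ}
    (hu : 0 < u) (hδ0 : 0 < δ) (hδ1 : δ ≤ 1) (hsum : u < ∑ j, z j)
    (hle : ∀ j, z j ≤ (1 - δ) * u) :
    ∃ a b, a ≠ b ∧ δ * u / (n + 1) < z a ∧ δ * u / (n + 1) < z b := by
  have hn : (0 : ℝ) < n + 1 := by positivity
  obtain ⟨a, -, ha⟩ : ∃ a ∈ Finset.univ, u / (n + 1) < z a := by
    refine Finset.exists_lt_of_sum_lt (lt_of_eq_of_lt ?_ hsum)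
    rw [Finset.sum_const, Finset.card_univ, Fintype.card_fin, nsmul_eq_mul]
    push_cast
    field_simp
  obtain ⟨b, hb, hzb⟩ : ∃ b ∈ Finset.univ.erase a, δ * u / (n + 1) < z b := by
    refine Finset.exists_lt_of_sum_lt ?_
    have h1 := Finset.add_sum_erase Finset.univ z (Finset.mem_univ a)
    rw [Finset.sum_const, Finset.card_erase_of_mem (Finset.mem_univ a), Finset.card_univ,
      Fintype.card_fin, nsmul_eq_mul, Nat.add_sub_cancel]
    have h2 : (n : ℝ) * (δ * u / (n + 1)) ≤ δ * u := by
      rw [mul_div_assoc', div_le_iff₀ hn]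
      nlinarith [mul_pos hδ0 hu]
    linarith [hle a]
  refine ⟨a, b, (Finset.ne_of_mem_erase hb).symm, lt_of_le_of_lt ?_ ha, hzb⟩
  gcongr
  exact mul_le_of_le_one_left hu.le hδ1

/-- Bonferroni's lower bound for the probability of a union. -/
theorem sum_measureReal_sub_le {Ω ι : Type*} [MeasurableSpace Ω] {P : Measure Ω}
    [IsFiniteMeasure P] [Fintype ι] [DecidableEq ι] {A : ι → Set Ω}
    (hA : ∀ j, MeasurableSet (A j)) {B : Set Ω} (hB : ∀ j, A j ⊆ B) :
    ∑ j, P.real (A j) - ∑ x ∈ Finset.univ.offDiag, P.real (A x.1 ∩ A x.2) ≤ P.real B := by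
  set D : ι → Set Ω := fun j => A j \ ⋃ b ∈ Finset.univ.erase j, A b with hD
  have hDm : ∀ j, MeasurableSet (D j) := fun j =>
    (hA j).diff (Finset.measurableSet_biUnion _ fun b _ => hA b)
  have hdisj : Pairwise (Function.onFun Disjoint D) := by
    intro i j hij
    refine disjoint_left.2 fun ω hi hj => hi.2 ?_
    exact mem_biUnion (by simp [hij.symm]) hj.1
  have h1 : ∀ j, P.real (A j) - ∑ b ∈ Finset.univ.erase j, P.real (A j ∩ A b) ≤ P.real (D j) := by
    intro j
    have hsub : A j ⊆ D j ∪ ⋃ b ∈ Finset.univ.erase j, A j ∩ A b := by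
      intro ω hω
      by_cases h : ω ∈ ⋃ b ∈ Finset.univ.erase j, A b
      · right
        obtain ⟨b, hb, hωb⟩ := mem_iUnion₂.1 h
        exact mem_biUnion hb ⟨hω, hωb⟩
      · exact Or.inl ⟨hω, h⟩
    have := (measureReal_mono (μ := P) hsub).trans ((measureReal_union_le _ _).trans
      (add_le_add_right (measureReal_biUnion_finset_le _ _) _))
    linarith
  have h2 : ∑ j, P.real (D j) ≤ P.real B := by
    rw [← measureReal_biUnion_finset (fun i _ j _ hij => hdisj hij) fun j _ => hDm j]
    exact measureReal_mono (iUnion₂_subset fun j _ => sdiff_subset.trans (hB j))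
  refine le_trans (le_of_eq ?_) ((Finset.sum_le_sum fun j _ => h1 j).trans h2)
  rw [Finset.sum_sub_distrib]
  congr 1
  rw [Finset.sum_sigma']
  refine Finset.sum_bij' (fun x _ => ⟨x.1, x.2⟩) (fun x _ => (x.1, x.2)) ?_ ?_ ?_ ?_ ?_ <;>
    simp [eq_comm]

/-! ### Tails of one and of two log-risks -/

/-- Standardized thresholds `(A - μ) / σ` and `(t - μ') / σ'` have ratio tending to `σ' / σ` when
`A ~ t`. -/
theorem tendsto_standardized_div {A : ℝ → ℝ} (hA : Tendsto (fun t => A t / t) atTop (𝓝 1))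
    (μ μ' : ℝ) {σ σ' : ℝ} (hσ : 0 < σ) (hσ' : 0 < σ') :
    Tendsto (fun t => ((A t - μ) / σ) / ((t - μ') / σ')) atTop (𝓝 (σ' / σ)) := by
  have h1 : Tendsto (fun t : ℝ => A t / t - μ / t) atTop (𝓝 (1 - 0)) :=
    hA.sub (tendsto_const_nhds.div_atTop tendsto_id)
  have h2 : Tendsto (fun t : ℝ => 1 - μ' / t) atTop (𝓝 (1 - 0)) :=
    tendsto_const_nhds.sub (tendsto_const_nhds.div_atTop tendsto_id)
  have h3 := ((h1.div h2 (by norm_num)).const_mul (σ' / σ))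
  simp only [sub_zero, div_one, mul_one] at h3
  refine h3.congr' ?_
  filter_upwards [eventually_gt_atTop 0, eventually_gt_atTop μ'] with t ht htμ
  have : t - μ' ≠ 0 := (sub_pos.2 htμ).ne'
  simp only [Pi.div_apply]
  have h4 : 1 - μ' / t ≠ 0 := by
    rw [one_sub_div ht.ne']; exact div_ne_zero this ht.ne'
  field_simp

theorem tendsto_standardized_atTop (μ : ℝ) {σ : ℝ} (hσ : 0 < σ) :
    Tendsto (fun t : ℝ => (t - μ) / σ) atTop atTop :=
  (tendsto_atTop_add_const_right _ (-μ) tendsto_id).atTop_div_const hσ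

theorem tendsto_atTop_of_div_tendsto_one {A : ℝ → ℝ}
    (hA : Tendsto (fun t => A t / t) atTop (𝓝 1)) : Tendsto A atTop atTop := by
  refine (hA.pos_mul_atTop one_pos tendsto_id).congr' ?_
  filter_upwards [eventually_ne_atTop 0] with t ht
  simp [div_mul_cancel₀ _ ht]

theorem tendsto_div_one_of_sub_mul_tendsto_zero {A : ℝ → ℝ}
    (hA : Tendsto (fun t => (A t - t) * t) atTop (𝓝 0)) :
    Tendsto (fun t => A t / t) atTop (𝓝 1) := by
  have h : Tendsto (fun t => (A t - t) * t / t ^ 2 + 1) atTop (𝓝 (0 + 1)) :=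
    (hA.div_atTop (tendsto_pow_atTop two_ne_zero)).add_const 1
  rw [zero_add] at h
  refine h.congr' ?_
  filter_upwards [eventually_ne_atTop 0] with t ht
  field_simp
  ring

/-- The logarithm `σⱼ Iⱼ √ζⱼ + μⱼ` of the log-chi risk. -/
noncomputable def logRisk {Ω : Type*} {k : ℕ} (σ μ : Fin k → ℝ) (I ζ : Fin k → Ω → ℝ)
    (j : Fin k) (ω : Ω) : ℝ :=
  σ j * I j ω * √(ζ j ω) + μ j

section Risks

variable {Ω : Type*} [MeasurableSpace Ω] {P : Measure Ω} {m n : ℕ}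
  {ρ : Fin n → ℝ} {X : Fin m → Fin (n + 1) → Ω → ℝ} {p : ℝ} {I : Fin (n + 1) → Ω → ℝ}
  {σ μ : Fin (n + 1) → ℝ}

theorem measurable_logRisk (hX : IsChiSquareArray P ρ X) (hI : IsRandomSigns P p I)
    (j : Fin (n + 1)) : Measurable (logRisk σ μ I (chiSquareRisk X) j) :=
  (((hI.measurable j).const_mul _).mul (hX.measurable_chiSquareRisk j).sqrt).add_const _

variable [IsProbabilityMeasure P]

theorem IsRandomSigns.ae_eq_one_or (hI : IsRandomSigns P p I) (j : Fin (n + 1)) :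
    ∀ᵐ ω ∂P, I j ω = 1 ∨ I j ω = -1 := by
  have hm1 : MeasurableSet {ω | I j ω = 1} := hI.measurable j (measurableSet_singleton 1)
  have hm2 : MeasurableSet {ω | I j ω = -1} := hI.measurable j (measurableSet_singleton (-1))
  have hdisj : Disjoint {ω | I j ω = 1} {ω | I j ω = -1} := by
    refine disjoint_left.2 fun ω (h1 : I j ω = 1) (h2 : I j ω = -1) => ?_
    linarith
  have h : P.real ({ω | I j ω = 1} ∪ {ω | I j ω = -1}) = 1 := by
    rw [measureReal_union hdisj hm2, hI.prob_one, hI.prob_neg_one]; ring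
  have h' : P ({ω | I j ω = 1} ∪ {ω | I j ω = -1}) = 1 := by
    rw [← ofReal_measureReal, h, ENNReal.ofReal_one]
  exact (mem_ae_iff_prob_eq_one (hm1.union hm2)).2 h'

/-- Above its centre `μⱼ`, the log-risk has `p` times the tail of the scaled chi distribution: only
the sign `+1` contributes. -/
theorem measureReal_lt_logRisk (hX : IsChiSquareArray P ρ X) (hI : IsRandomSigns P p I)
    (hIX : IndepFun (fun ω j => I j ω) (fun ω j => chiSquareRisk X j ω) P) (hm : 1 ≤ m)
    {j : Fin (n + 1)} (hσ : 0 < σ j) {A : ℝ} (hA : μ j < A) :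
    P.real {ω | A < logRisk σ μ I (chiSquareRisk X) j ω} =
      p * (((2 : ℝ) ^ ((m : ℝ) / 2 - 1) * Real.Gamma ((m : ℝ) / 2))⁻¹ *
        ∫ y in Ioi ((A - μ j) / σ j), y ^ (m - 1) * Real.exp (-y ^ 2 / 2)) := by
  have hr : 0 ≤ (A - μ j) / σ j := div_nonneg (by linarith) hσ.le
  rw [← hX.measureReal_lt_sqrt hm j hr, ← hI.prob_one j]
  have hind := hIX.measure_inter_preimage_eq_mul {x | x j = 1} {x | (A - μ j) / σ j < √(x j)}
    (measurable_pi_apply j (measurableSet_singleton 1))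
    (measurableSet_lt measurable_const (by fun_prop))
  rw [Measure.real, Measure.real, Measure.real, ← ENNReal.toReal_mul]
  refine congrArg ENNReal.toReal (Eq.trans (measure_congr ?_) hind)
  filter_upwards [hI.ae_eq_one_or j] with ω hω
  have hs := Real.sqrt_nonneg (chiSquareRisk X j ω)
  refine propext ?_
  change A < σ j * I j ω * √(chiSquareRisk X j ω) + μ j ↔
    I j ω = 1 ∧ (A - μ j) / σ j < √(chiSquareRisk X j ω)
  rw [div_lt_iff₀ hσ]
  rcases hω with h | h
  · rw [h]
    constructor
    · intro h'; exact ⟨rfl, by linarith⟩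
    · rintro ⟨-, h'⟩; linarith
  · rw [h]
    have h0 : 0 ≤ σ j * √(chiSquareRisk X j ω) := mul_nonneg hσ.le hs
    constructor
    · intro h'; linarith
    · rintro ⟨h', -⟩; norm_num at h'

/-- Almost surely a log-risk above `A` forces `ζⱼ ≥ ((A - μⱼ) / σⱼ)²`. -/
theorem ae_sq_le_of_lt_logRisk (hI : IsRandomSigns P p I)
    {j : Fin (n + 1)} (hσ : 0 < σ j) {A : ℝ} (hA : μ j < A) :
    ∀ᵐ ω ∂P, A < logRisk σ μ I (chiSquareRisk X) j ω →
      ((A - μ j) / σ j) ^ 2 ≤ chiSquareRisk X j ω := by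
  filter_upwards [hI.ae_eq_one_or j] with ω hω hlt
  have hs := Real.sqrt_nonneg (chiSquareRisk X j ω)
  have hlt' : A < σ j * I j ω * √(chiSquareRisk X j ω) + μ j := hlt
  have h0 : 0 ≤ σ j * √(chiSquareRisk X j ω) := mul_nonneg hσ.le hs
  have hle : (A - μ j) / σ j ≤ √(chiSquareRisk X j ω) := by
    rw [div_le_iff₀ hσ]
    rcases hω with h | h <;> rw [h] at hlt' <;> linarith
  calc ((A - μ j) / σ j) ^ 2 ≤ √(chiSquareRisk X j ω) ^ 2 :=
        pow_le_pow_left₀ (div_nonneg (by linarith) hσ.le) hle 2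
    _ = chiSquareRisk X j ω := Real.sq_sqrt (chiSquareRisk_nonneg X j ω)

/-- A marginal tail with a slightly perturbed threshold, relative to the leading order: only the
indices maximizing first `σ` and then `μ` contribute. -/
theorem tendsto_marginal_div (hX : IsChiSquareArray P ρ X) (hI : IsRandomSigns P p I)
    (hIX : IndepFun (fun ω j => I j ω) (fun ω j => chiSquareRisk X j ω) P) (hm : 1 ≤ m)
    (hσ_pos : ∀ j, 0 < σ j) (hσ_anti : Antitone σ) (j : Fin (n + 1)) {A : ℝ → ℝ}
    (hA : Tendsto (fun t => (A t - t) * t) atTop (𝓝 0)) :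
    Tendsto (fun t => P.real {ω | A t < logRisk σ μ I (chiSquareRisk X) j ω} /
        chiTailShape m ((t - muTilde σ μ) / σ 0)) atTop
      (𝓝 (p * (((2 : ℝ) ^ ((m : ℝ) / 2 - 1) * Real.Gamma ((m : ℝ) / 2))⁻¹ *
        if σ j = σ 0 ∧ μ j = muTilde σ μ then 1 else 0))) := by
  have hA1 := tendsto_div_one_of_sub_mul_tendsto_zero hA
  have hAtop := tendsto_atTop_of_div_tendsto_one hA1
  have hy := tendsto_standardized_atTop (muTilde σ μ) (hσ_pos 0)
  have hx : Tendsto (fun t => (A t - μ j) / σ j) atTop atTop :=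
    (tendsto_standardized_atTop (μ j) (hσ_pos j)).comp hAtop
  have hxy := tendsto_standardized_div hA1 (μ j) (muTilde σ μ) (hσ_pos j) (hσ_pos 0)
  suffices hshape : Tendsto (fun t => chiTailShape m ((A t - μ j) / σ j) /
      chiTailShape m ((t - muTilde σ μ) / σ 0)) atTop
      (𝓝 (if σ j = σ 0 ∧ μ j = muTilde σ μ then 1 else 0)) by
    have hG := (integral_Ioi_isEquivalent_chiTailShape m hm).comp_tendsto hx
    have hG1 := (isEquivalent_iff_tendsto_one (by
      filter_upwards [hx.eventually_gt_atTop 0] with t ht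
      exact (chiTailShape_pos m ht).ne')).1 hG
    have h := ((hG1.mul hshape).const_mul
      (((2 : ℝ) ^ ((m : ℝ) / 2 - 1) * Real.Gamma ((m : ℝ) / 2))⁻¹)).const_mul p
    rw [one_mul] at h
    refine h.congr' ?_
    filter_upwards [hx.eventually_gt_atTop 0, hAtop.eventually_gt_atTop (μ j)] with t ht hμt
    rw [measureReal_lt_logRisk hX hI hIX hm (hσ_pos j) hμt]
    simp only [Pi.div_apply, Function.comp_apply]
    rw [div_mul_div_cancel₀ (chiTailShape_pos m ht).ne', mul_div_assoc, mul_div_assoc]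
  -- the difference of the squared standardized thresholds decides
  by_cases hσj : σ j = σ 0
  · rw [hσj, div_self (hσ_pos 0).ne'] at hxy
    have hdiff : ∀ t, ((t - muTilde σ μ) / σ 0) ^ 2 - ((A t - μ j) / σ 0) ^ 2 =
        -((A t - t) + (muTilde σ μ - μ j)) / σ 0 ^ 2 *
          (2 * t + ((A t - t) - muTilde σ μ - μ j)) := by
      intro t
      have := (hσ_pos 0).ne'
      field_simp
      ring
    have he : Tendsto (fun t => A t - t) atTop (𝓝 0) := by
      refine (hA.div_atTop tendsto_id).congr' ?_
      filter_upwards [eventually_ne_atTop 0] with t ht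
      exact mul_div_cancel_right₀ _ ht
    by_cases hμj : μ j = muTilde σ μ
    · rw [if_pos ⟨hσj, hμj⟩, hσj]
      have hexp : Tendsto (fun t => Real.exp ((((t - muTilde σ μ) / σ 0) ^ 2 -
          ((A t - μ j) / σ 0) ^ 2) / 2)) atTop (𝓝 1) := by
        rw [← Real.exp_zero]
        refine (Real.continuous_exp.tendsto 0).comp ?_
        have h : Tendsto (fun t => -(2 * ((A t - t) * t) +
            (A t - t) * ((A t - t) - muTilde σ μ - μ j)) / σ 0 ^ 2 / 2) atTop
            (𝓝 (-(2 * 0 + 0 * (0 - muTilde σ μ - μ j)) / σ 0 ^ 2 / 2)) :=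
          ((((hA.const_mul 2).add (he.mul ((he.sub_const _).sub_const _))).neg).div_const
            _).div_const _
        simp only [mul_zero, zero_mul, add_zero, neg_zero, zero_div] at h
        refine h.congr fun t => ?_
        rw [hdiff t, hμj]
        ring
      simpa using tendsto_chiTailShape_div m one_pos hy hxy hexp
    · rw [if_neg (fun h => hμj h.2), hσj]
      have hlt : 0 < muTilde σ μ - μ j := by
        refine sub_pos.2 (lt_of_le_of_ne ?_ hμj)
        exact Finset.le_sup' μ (by simp [hσj])
      have hexp : Tendsto (fun t => Real.exp ((((t - muTilde σ μ) / σ 0) ^ 2 -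
          ((A t - μ j) / σ 0) ^ 2) / 2)) atTop (𝓝 0) := by
        refine Real.tendsto_exp_atBot.comp (Tendsto.atBot_div_const (by norm_num) ?_)
        have h1 : Tendsto (fun t => -((A t - t) + (muTilde σ μ - μ j)) / σ 0 ^ 2) atTop
            (𝓝 (-(0 + (muTilde σ μ - μ j)) / σ 0 ^ 2)) := ((he.add_const _).neg).div_const _
        have h2 : Tendsto (fun t => 2 * t + ((A t - t) - muTilde σ μ - μ j)) atTop atTop :=
          (tendsto_id.const_mul_atTop two_pos).atTop_add ((he.sub_const _).sub_const _)
        refine (h1.neg_mul_atTop ?_ h2).congr fun t => (hdiff t).symm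
        rw [zero_add]
        exact div_neg_of_neg_of_pos (neg_neg_of_pos hlt) (pow_pos (hσ_pos 0) 2)
      simpa using tendsto_chiTailShape_div m one_pos hy hxy hexp
  · rw [if_neg (fun h => hσj h.1)]
    have hlt : σ j < σ 0 := lt_of_le_of_ne (hσ_anti (Fin.zero_le j)) hσj
    have hq : 1 < σ 0 / σ j := (one_lt_div (hσ_pos j)).2 hlt
    have hexp : Tendsto (fun t => Real.exp ((((t - muTilde σ μ) / σ 0) ^ 2 -
        ((A t - μ j) / σ j) ^ 2) / 2)) atTop (𝓝 0) := by
      refine Real.tendsto_exp_atBot.comp (Tendsto.atBot_div_const (by norm_num) ?_)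
      have h1 := ((hxy.pow 2).const_sub 1).neg_mul_atTop (by nlinarith)
        ((tendsto_pow_atTop two_ne_zero).comp hy)
      refine h1.congr' ?_
      filter_upwards [hy.eventually_gt_atTop 0] with t ht
      simp only [Function.comp_apply]
      rw [sub_mul, one_mul, ← mul_pow, div_mul_cancel₀ _ ht.ne']
    simpa using tendsto_chiTailShape_div m (zero_lt_one.trans hq) hy hxy hexp

/-- Chernoff's bound against the leading order: an event on which `Y ≥ E`, where `s E` grows faster
than half the square of the leading standardized threshold, is negligible. -/
theorem tendsto_measureReal_div_of_chernoff {A : ℝ → Set Ω} {Y : Ω → ℝ} {E y : ℝ → ℝ} {s c : ℝ}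
    (hs : 0 ≤ s) (hint : Integrable (fun ω => Real.exp (s * Y ω)) P)
    (hAE : ∀ᶠ t in atTop, ∀ᵐ ω ∂P, ω ∈ A t → E t ≤ Y ω) (hy : Tendsto y atTop atTop)
    (hE : Tendsto (fun t => E t / y t ^ 2) atTop (𝓝 c)) (hc : 1 / 2 < s * c) :
    Tendsto (fun t => P.real (A t) / chiTailShape m (y t)) atTop (𝓝 0) := by
  have hsE : Tendsto (fun t => s * E t / y t ^ 2) atTop (𝓝 (s * c)) := by
    simpa only [mul_div_assoc] using hE.const_mul s
  have hlim := (tendsto_exp_neg_div_chiTailShape m hc hy hsE).mul_const (mgf Y P s)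
  rw [zero_mul] at hlim
  refine squeeze_zero' ?_ ?_ hlim
  · filter_upwards [hy.eventually_gt_atTop 0] with t ht
    exact div_nonneg measureReal_nonneg (chiTailShape_pos m ht).le
  · filter_upwards [hy.eventually_gt_atTop 0, hAE] with t ht hAt
    rw [div_mul_eq_mul_div]
    refine div_le_div_of_nonneg_right ?_ (chiTailShape_pos m ht).le
    have h1 : P.real (A t) ≤ P.real {ω | E t ≤ Y ω} :=
      ENNReal.toReal_mono (measure_ne_top _ _) (measure_mono_ae hAt)
    refine h1.trans ((measure_ge_le_exp_mul_mgf (E t) hs hint).trans_eq ?_)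
    rw [neg_mul]

/-- Two different log-risks exceed thresholds of leading order `t` simultaneously with a probability
that is negligible against the leading order. -/
theorem tendsto_pair_div (hX : IsChiSquareArray P ρ X) (hI : IsRandomSigns P p I)
    (hσ_pos : ∀ j, 0 < σ j) (hσ_anti : Antitone σ)
    (hcorr : ∀ i a b, a ≠ b → σ a = σ 0 → σ b = σ 0 → |covariance (X i a) (X i b) P| < 1)
    {a b : Fin (n + 1)} (hab : a ≠ b) {A : ℝ → ℝ}
    (hA : Tendsto (fun t => A t / t) atTop (𝓝 1)) :
    Tendsto (fun t => P.real ({ω | A t < logRisk σ μ I (chiSquareRisk X) a ω} ∩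
        {ω | A t < logRisk σ μ I (chiSquareRisk X) b ω}) /
        chiTailShape m ((t - muTilde σ μ) / σ 0)) atTop (𝓝 0) := by
  have hy := tendsto_standardized_atTop (muTilde σ μ) (hσ_pos 0)
  have hAtop := tendsto_atTop_of_div_tendsto_one hA
  have hratio : ∀ j, Tendsto (fun t => ((A t - μ j) / σ j) ^ 2 /
      ((t - muTilde σ μ) / σ 0) ^ 2) atTop (𝓝 ((σ 0 / σ j) ^ 2)) := fun j => by
    simpa only [div_pow _ _ 2] using
      (tendsto_standardized_div hA (μ j) (muTilde σ μ) (hσ_pos j) (hσ_pos 0)).pow 2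
  have hae : ∀ j, ∀ᶠ t in atTop, ∀ᵐ ω ∂P, A t < logRisk σ μ I (chiSquareRisk X) j ω →
      ((A t - μ j) / σ j) ^ 2 ≤ chiSquareRisk X j ω := fun j => by
    filter_upwards [hAtop.eventually_gt_atTop (μ j)] with t ht
    exact ae_sq_le_of_lt_logRisk hI (hσ_pos j) ht
  -- if one of the two scales is not maximal, its own tail is already negligible
  have hsmall : ∀ j, σ j ≠ σ 0 → ∀ B : ℝ → Set Ω,
      (∀ t, B t ⊆ {ω | A t < logRisk σ μ I (chiSquareRisk X) j ω}) →
      Tendsto (fun t => P.real (B t) / chiTailShape m ((t - muTilde σ μ) / σ 0)) atTop (𝓝 0) := by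
    intro j hj B hB
    have hlt : σ j < σ 0 := lt_of_le_of_ne (hσ_anti (Fin.zero_le j)) hj
    have hq : 1 < (σ 0 / σ j) ^ 2 := one_lt_pow₀ ((one_lt_div (hσ_pos j)).2 hlt) two_ne_zero
    obtain ⟨s, hs1, hs2⟩ : ∃ s : ℝ, 1 / 2 / (σ 0 / σ j) ^ 2 < s ∧ s < 1 / 2 :=
      exists_between (div_lt_self (by norm_num) hq)
    have hs0 : 0 < s := lt_trans (by positivity) hs1
    rw [div_lt_iff₀ (by positivity)] at hs1
    refine tendsto_measureReal_div_of_chernoff hs0.le (hX.integrable_exp j hs2) ?_ hy (hratio j) hs1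
    filter_upwards [hae j] with t ht
    filter_upwards [ht] with ω hω hωB
    exact hω (hB t hωB)
  by_cases ha : σ a = σ 0
  · by_cases hb : σ b = σ 0
    · obtain ⟨s, hs, hint⟩ := hX.exists_integrable_exp_add fun i => hcorr i a b hab ha hb
      have hE : Tendsto (fun t => (((A t - μ a) / σ a) ^ 2 + ((A t - μ b) / σ b) ^ 2) /
          ((t - muTilde σ μ) / σ 0) ^ 2) atTop (𝓝 2) := by
        have := (hratio a).add (hratio b)
        rw [ha, hb, div_self (hσ_pos 0).ne', one_pow, one_add_one_eq_two] at this
        simpa only [add_div, ha, hb] using this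
      refine tendsto_measureReal_div_of_chernoff (by linarith) hint ?_ hy hE (by linarith)
      filter_upwards [hae a, hae b] with t hta htb
      filter_upwards [hta, htb] with ω hωa hωb hω
      exact add_le_add (hωa hω.1) (hωb hω.2)
    · exact hsmall b hb _ fun t => inter_subset_right
  · exact hsmall a ha _ fun t => inter_subset_left

end Risks

/-! ### The tail of the sum -/

theorem maxCount_pos {n : ℕ} (σ μ : Fin (n + 1) → ℝ) : 0 < maxCount σ μ := by
  obtain ⟨j, hj, hμ⟩ := Finset.exists_mem_eq_sup'
    (⟨0, by simp⟩ : (Finset.univ.filter (fun j => σ j = σ 0)).Nonempty) μ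
  exact Finset.card_pos.2 ⟨j, by
    simp only [Finset.mem_filter, Finset.mem_univ, true_and] at hj ⊢
    exact ⟨hj, hμ.symm⟩⟩

/-- The large-deviation decomposition of the sum of the risks at level `exp t`: either one risk
exceeds `exp (t - t⁻²)`, or two risks exceed `exp t / (2 (n + 1) t²)`. -/
theorem setOf_lt_sum_logChiRisk_subset {Ω : Type*} {n : ℕ} (σ μ : Fin (n + 1) → ℝ)
    (I ζ : Fin (n + 1) → Ω → ℝ) {t : ℝ} (ht : 1 ≤ t) :
    {ω | Real.exp t < ∑ j, logChiRisk σ μ I ζ j ω} ⊆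
      (⋃ j ∈ Finset.univ, {ω | t - (t ^ 2)⁻¹ < logRisk σ μ I ζ j ω}) ∪
      ⋃ x ∈ (Finset.univ : Finset (Fin (n + 1))).offDiag,
        ({ω | t - 2 * Real.log t - Real.log (2 * (n + 1)) < logRisk σ μ I ζ x.1 ω} ∩
          {ω | t - 2 * Real.log t - Real.log (2 * (n + 1)) < logRisk σ μ I ζ x.2 ω}) := by
  intro ω hω
  have hω : Real.exp t < ∑ j, logChiRisk σ μ I ζ j ω := hω
  by_cases h : ∃ j, t - (t ^ 2)⁻¹ < logRisk σ μ I ζ j ω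
  · obtain ⟨j, hj⟩ := h
    exact Or.inl (mem_biUnion (Finset.mem_univ j) hj)
  push Not at h
  right
  have ht0 : 0 < t := by linarith
  set s : ℝ := (t ^ 2)⁻¹ with hs
  have hs0 : 0 < s := by positivity
  have hs1 : s ≤ 1 := inv_le_one_of_one_le₀ (one_le_pow₀ ht)
  -- `δ = 1 - exp (-s)` satisfies `s / 2 ≤ δ ≤ 1`, as `exp (-s) ≤ 1 / (1 + s) ≤ 1 - s / 2`
  have hδ : s / 2 ≤ 1 - Real.exp (-s) := by
    have h1 : Real.exp (-s) * (1 + s) ≤ 1 := by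
      calc Real.exp (-s) * (1 + s) ≤ Real.exp (-s) * Real.exp s := by
            gcongr; linarith [Real.add_one_le_exp s]
        _ = 1 := by rw [← Real.exp_add, neg_add_cancel, Real.exp_zero]
    have h2 : 1 ≤ (1 - s / 2) * (1 + s) := by nlinarith
    have h3 := le_of_mul_le_mul_right (h1.trans h2) (by linarith)
    linarith
  obtain ⟨a, b, hab, ha, hb⟩ := exists_ne_lt_of_lt_sum (δ := 1 - Real.exp (-s)) (Real.exp_pos t)
    (by linarith) (by linarith [Real.exp_pos (-s)]) hω (fun j => by
      rw [sub_sub_cancel, ← Real.exp_add]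
      exact Real.exp_le_exp.2 (by have := h j; unfold logRisk at this; linarith))
  have hlow : Real.exp (t - 2 * Real.log t - Real.log (2 * (n + 1))) ≤
      (1 - Real.exp (-s)) * Real.exp t / (n + 1) := by
    have hn : (0 : ℝ) < n + 1 := by positivity
    rw [Real.exp_sub, Real.exp_sub, Real.exp_log (by positivity), two_mul (Real.log t),
      Real.exp_add, Real.exp_log ht0]
    calc Real.exp t / (t * t) / (2 * (n + 1)) = s / 2 * Real.exp t / (n + 1) := by
          rw [hs]; field_simp
      _ ≤ _ := by gcongr
  refine mem_biUnion (x := (a, b)) (by simpa using hab) ⟨?_, ?_⟩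
  · exact Real.exp_lt_exp.1 (hlow.trans_lt ha)
  · exact Real.exp_lt_exp.1 (hlow.trans_lt hb)

/-- The asymptotics of the tail of the sum, in the variable `t = log u`. -/
theorem tendsto_measureReal_sum_div {Ω : Type*} [MeasurableSpace Ω] {P : Measure Ω}
    [IsProbabilityMeasure P] {m n : ℕ} (hm : 1 ≤ m)
    {ρ : Fin n → ℝ} {X : Fin m → Fin (n + 1) → Ω → ℝ} (hX : IsChiSquareArray P ρ X)
    {p : ℝ} {I : Fin (n + 1) → Ω → ℝ} (hI : IsRandomSigns P p I)
    (hIX : IndepFun (fun ω j => I j ω) (fun ω j => chiSquareRisk X j ω) P)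
    {σ μ : Fin (n + 1) → ℝ} (hσ_pos : ∀ j, 0 < σ j) (hσ_anti : Antitone σ)
    (hcorr : ∀ i a b, a ≠ b → σ a = σ 0 → σ b = σ 0 → |covariance (X i a) (X i b) P| < 1) :
    Tendsto (fun t => P.real {ω | Real.exp t < ∑ j, logChiRisk σ μ I (chiSquareRisk X) j ω} /
        chiTailShape m ((t - muTilde σ μ) / σ 0)) atTop
      (𝓝 (p * (((2 : ℝ) ^ ((m : ℝ) / 2 - 1) * Real.Gamma ((m : ℝ) / 2))⁻¹ * maxCount σ μ))) := by
  have hy := tendsto_standardized_atTop (muTilde σ μ) (hσ_pos 0)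
  have hmarg : ∀ A : ℝ → ℝ, Tendsto (fun t => (A t - t) * t) atTop (𝓝 0) →
      Tendsto (fun t => ∑ j, P.real {ω | A t < logRisk σ μ I (chiSquareRisk X) j ω} /
        chiTailShape m ((t - muTilde σ μ) / σ 0)) atTop
      (𝓝 (p * (((2 : ℝ) ^ ((m : ℝ) / 2 - 1) * Real.Gamma ((m : ℝ) / 2))⁻¹ * maxCount σ μ))) := by
    intro A hA
    have := tendsto_finsetSum Finset.univ fun j _ =>
      tendsto_marginal_div (μ := μ) hX hI hIX hm hσ_pos hσ_anti j hA
    rwa [← Finset.mul_sum, ← Finset.mul_sum, Finset.sum_boole, ← maxCount] at this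
  have hpair : ∀ A : ℝ → ℝ, Tendsto (fun t => A t / t) atTop (𝓝 1) →
      Tendsto (fun t => ∑ x ∈ (Finset.univ : Finset (Fin (n + 1))).offDiag,
        P.real ({ω | A t < logRisk σ μ I (chiSquareRisk X) x.1 ω} ∩
          {ω | A t < logRisk σ μ I (chiSquareRisk X) x.2 ω}) /
        chiTailShape m ((t - muTilde σ μ) / σ 0)) atTop (𝓝 0) := by
    intro A hA
    have := tendsto_finsetSum (Finset.univ : Finset (Fin (n + 1))).offDiag fun x hx =>
      tendsto_pair_div (μ := μ) hX hI hσ_pos hσ_anti hcorr (Finset.mem_offDiag.1 hx).2.2 hA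
    simpa only [Finset.sum_const_zero] using this
  have hA0 : Tendsto (fun t : ℝ => t / t) atTop (𝓝 1) :=
    tendsto_div_one_of_sub_mul_tendsto_zero (by simp)
  have hA1 : Tendsto (fun t : ℝ => (t - (t ^ 2)⁻¹ - t) * t) atTop (𝓝 0) := by
    have : Tendsto (fun t : ℝ => -t⁻¹) atTop (𝓝 (-0)) := tendsto_inv_atTop_zero.neg
    rw [neg_zero] at this
    refine this.congr' ?_
    filter_upwards [eventually_ne_atTop 0] with t ht
    field_simp
    ring
  have hA2 : Tendsto (fun t : ℝ => (t - 2 * Real.log t - Real.log (2 * (n + 1))) / t) atTop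
      (𝓝 1) := by
    have h1 : Tendsto (fun t : ℝ => Real.log t / t) atTop (𝓝 0) :=
      Real.isLittleO_log_id_atTop.tendsto_div_nhds_zero
    have h2 : Tendsto (fun t : ℝ => Real.log (2 * (n + 1)) / t) atTop (𝓝 0) :=
      tendsto_const_nhds.div_atTop tendsto_id
    have h3 := (hA0.sub (h1.const_mul 2)).sub h2
    rw [mul_zero, sub_zero, sub_zero] at h3
    refine h3.congr fun t => ?_
    rw [sub_div, sub_div, mul_div_assoc]
  have hlower := (hmarg (fun t => t) (by simp)).sub (hpair (fun t => t) hA0)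
  have hupper := (hmarg _ hA1).add (hpair _ hA2)
  rw [sub_zero] at hlower
  rw [add_zero] at hupper
  refine tendsto_of_tendsto_of_tendsto_of_le_of_le' hlower hupper ?_ ?_
  · filter_upwards [hy.eventually_gt_atTop 0] with t ht
    rw [← Finset.sum_div, ← Finset.sum_div, ← sub_div]
    refine div_le_div_of_nonneg_right ?_ (chiTailShape_pos m ht).le
    refine sum_measureReal_sub_le
      (fun j => measurableSet_lt measurable_const (measurable_logRisk hX hI j)) fun j ω hω => ?_
    exact (Real.exp_lt_exp.2 hω).trans_le
      (Finset.single_le_sum (f := fun j => logChiRisk σ μ I (chiSquareRisk X) j ω)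
        (fun i _ => (Real.exp_pos _).le) (Finset.mem_univ j))
  · filter_upwards [hy.eventually_gt_atTop 0, eventually_ge_atTop 1] with t ht ht1
    rw [← Finset.sum_div, ← Finset.sum_div, ← add_div]
    refine div_le_div_of_nonneg_right ?_ (chiTailShape_pos m ht).le
    refine (measureReal_mono (setOf_lt_sum_logChiRisk_subset σ μ I (chiSquareRisk X) ht1)).trans
      ((measureReal_union_le _ _).trans ?_)
    exact add_le_add (measureReal_biUnion_finset_le _ _) (measureReal_biUnion_finset_le _ _)

theorem mainTheorem5 {Ω : Type*} [MeasurableSpace Ω] (P : Measure Ω) [IsProbabilityMeasure P]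
    (m n : ℕ) (hm : 1 ≤ m) (hn : 2 ≤ n + 1)
    (ρ : Fin n → ℝ) (X : Fin m → Fin (n + 1) → Ω → ℝ) (hX : IsChiSquareArray P ρ X)
    (p : ℝ) (hp : p ∈ Set.Ioc (0 : ℝ) 1)
    (I : Fin (n + 1) → Ω → ℝ) (hI : IsRandomSigns P p I)
    (hIX : IndepFun (fun ω j => I j ω) (fun ω j => chiSquareRisk X j ω) P)
    (σ μ : Fin (n + 1) → ℝ) (hσ_pos : ∀ j, 0 < σ j) (hσ_anti : Antitone σ)
    (hcorr : ∀ i a b, a ≠ b → σ a = σ 0 → σ b = σ 0 →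
      |covariance (X i a) (X i b) P| < 1) :
    (fun u : ℝ => P.real {ω | u < ∑ j, logChiRisk σ μ I (chiSquareRisk X) j ω}) ~[atTop]
      (fun u : ℝ =>
        p * (maxCount σ μ : ℝ) /
            ((2 : ℝ) ^ ((m : ℝ) / 2 - 1) * Real.Gamma ((m : ℝ) / 2) * σ 0 ^ ((m : ℤ) - 2)) *
          (Real.log u - muTilde σ μ) ^ ((m : ℤ) - 2) *
          Real.exp (-(Real.log u - muTilde σ μ) ^ 2 / (2 * σ 0 ^ 2))) := by
  have hJ : (0 : ℝ) < maxCount σ μ := by exact_mod_cast maxCount_pos σ μ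
  have hG : 0 < Real.Gamma ((m : ℝ) / 2) :=
    Real.Gamma_pos_of_pos (div_pos (by exact_mod_cast hm) two_pos)
  have hp0 := hp.1
  set K : ℝ := p * (((2 : ℝ) ^ ((m : ℝ) / 2 - 1) * Real.Gamma ((m : ℝ) / 2))⁻¹ * maxCount σ μ)
    with hK
  have hK0 : 0 < K := by positivity
  have hy := (tendsto_standardized_atTop (muTilde σ μ) (hσ_pos 0)).comp Real.tendsto_log_atTop
  have hshape : ∀ u : ℝ, p * (maxCount σ μ : ℝ) /
        ((2 : ℝ) ^ ((m : ℝ) / 2 - 1) * Real.Gamma ((m : ℝ) / 2) * σ 0 ^ ((m : ℤ) - 2)) *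
        (Real.log u - muTilde σ μ) ^ ((m : ℤ) - 2) *
        Real.exp (-(Real.log u - muTilde σ μ) ^ 2 / (2 * σ 0 ^ 2)) =
      K * chiTailShape m ((Real.log u - muTilde σ μ) / σ 0) := by
    intro u
    have h1 : σ 0 ^ ((m : ℤ) - 2) ≠ 0 := (zpow_pos (hσ_pos 0) _).ne'
    have h2 : -((Real.log u - muTilde σ μ) / σ 0) ^ 2 / 2 =
        -(Real.log u - muTilde σ μ) ^ 2 / (2 * σ 0 ^ 2) := by
      have := (hσ_pos 0).ne'
      field_simp
    rw [chiTailShape, h2, div_zpow, hK]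
    field_simp
  simp only [hshape]
  have hlim := ((tendsto_measureReal_sum_div (μ := μ) hm hX hI hIX hσ_pos hσ_anti hcorr).comp
    Real.tendsto_log_atTop).div_const K
  rw [← hK, div_self hK0.ne'] at hlim
  refine (isEquivalent_iff_tendsto_one ?_).2 (hlim.congr' ?_)
  · filter_upwards [hy.eventually_gt_atTop 0] with u hu
    exact (mul_pos hK0 (chiTailShape_pos m hu)).ne'
  · filter_upwards [eventually_gt_atTop 0] with u hu
    simp only [Function.comp_apply, Pi.div_apply, Real.exp_log hu]
    rw [div_div, mul_comm K]
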